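/- Let $M$ be a $C^\infty$ manifold of dimension $n\neq 1$, let $TM_0=TM\setminus\{0\}$ with projection $\pi:TM_0\to M$, and let $F:TM\to[0,\infty)$ be a Finsler structure: $F$ is $C^\infty$ on $TM_0$, $F(x,ty)=tF(x,y)$ for $t>0$, and $g_{ij}(x,y)=\frac12[F^2]_{y^iy^j}$ is positive definite on $TM_0$. Let $A_{ijk}=\frac F2\,\frac{\partial g_{ij}}{\partial y^k}=\frac F4[F^2]_{y^iy^jy^k}$ be the Cartan tensor, regarded with $g$ as a tensor on $\pi^*TM$, and let $\ell_z=z/F(z)$ be the canonical section of $\pi^*TM$. $F$ is called Riemannian if $g_{ij}(x,y)$ is independent of $y\neq 0$. Let $\rho=d\pi:T(TM_0)\to\pi^*TM$. A Finsler connection is a linear connection $D$ on $\pi^*TM$ such that, for every $z\in TM_0$, the map $\mu_z:V\mapsto D_V(F\ell)$ restricts to an isomorphism of $\ker\rho_z$ onto $T_{\pi(z)}M$; let $\bar\ell$ be the vector field on $TM_0$ with $\mu(\bar\ell)=0$ and $\rho(\bar\ell)=\ell$, and put $\overset{0}{A}=A$ and $$\overset{i+1}{A}(X,Y,Z)=\bar\ell\,\overset{i}{A}(X,Y,Z)-\overset{i}{A}(D_{\bar\ell}X,Y,Z)-\overset{i}{A}(X,D_{\bar\ell}Y,Z)-\overset{i}{A}(X,Y,D_{\bar\ell}Z).$$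 Say that $D$ is torsion-free and almost compatible with tensor $S$, where $S$ is a symmetric $3$-tensor on $\pi^*TM$ with $S(X,Y,\ell)=0$ that is positively homogeneous of degree $0$ in $y$, if for all vector fields $V,W$ on $TM_0$ and all sections $X,Y$ of $\pi^*TM$ $$D_V\rho(W)-D_W\rho(V)=\rho[V,W],$$ $$Vg(X,Y)-g(D_VX,Y)-g(X,D_VY)=2A(\rho(V),X,Y)+2F^{-1}A(\mu(V),X,Y)-2S(\rho(V),X,Y).$$ Let $m\ge 0$ and let $\kappa_1,\dots,\kappa_m$ be real constants. The Berwald-type connection $D^B$ with these constants is the Finsler connection that is torsion-free and almost compatible with $S=A+\kappa_1\overset{1}{A}+\cdots+\kappa_m\overset{m}{A}$, and the Shen-type connection $D^S$ with the same constants is the one that is torsion-free and almost compatible with $S=\kappa_1\overset{1}{A}+\cdots+\kappa_m\overset{m}{A}$, the tensors $\overset{i}{A}$ being formed with the connection in question. Then $D^B$ and $D^S$ coincide if and only if $F$ is Riemannian. -/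

import Mathlib

open Bundle Set
open scoped Manifold ContDiff

noncomputable section

namespace FinslerGeom

variable {E : Type*} [NormedAddCommGroup E] [NormedSpace ℝ E]
  {M : Type*} [TopologicalSpace M] [ChartedSpace E M] [IsManifold 𝓘(ℝ, E) ∞ M]

/-! ## Finsler structures

Throughout, `M` is a smooth manifold without boundary modelled on a (finite-dimensional) real
vector space `E`; a point `z = (x, y)` of `TM` is written `z : TangentBundle 𝓘(ℝ, E) M`, with
`z.proj = x` and `z.2 = y ∈ T_x M`. -/

variable (E M) in
/-- The slit tangent bundle `TM₀`, as an open subset of `TM`. -/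
def slit : Set (TangentBundle 𝓘(ℝ, E) M) := {z | z.2 ≠ 0}

/-- The function `y ↦ F(x, y)²` on the vector space `T_x M` (which is `E` as a vector space). -/
def sqOnFiber (F : TangentBundle 𝓘(ℝ, E) M → ℝ) (x : M) : E → ℝ :=
  fun y => F (⟨x, y⟩ : TangentBundle 𝓘(ℝ, E) M) ^ 2

/-- The fundamental tensor `g_{(x,y)}(u, v) = ½ ∂²F²/∂yⁱ∂yʲ uⁱ vʲ`. -/
def fundamentalTensor (F : TangentBundle 𝓘(ℝ, E) M → ℝ) (z : TangentBundle 𝓘(ℝ, E) M)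
    (u v : TangentSpace 𝓘(ℝ, E) z.proj) : ℝ :=
  (1 / 2) * iteratedFDeriv ℝ 2 (sqOnFiber F z.proj) z.2 ![u, v]

/-- The Cartan tensor
`A_{(x,y)}(u, v, w) = ½ F ∂g_{ij}/∂yᵏ uⁱ vʲ wᵏ = ¼ F ∂³F²/∂yⁱ∂yʲ∂yᵏ uⁱ vʲ wᵏ`. -/
def cartanTensor (F : TangentBundle 𝓘(ℝ, E) M → ℝ) (z : TangentBundle 𝓘(ℝ, E) M)
    (u v w : TangentSpace 𝓘(ℝ, E) z.proj) : ℝ :=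
  (1 / 4) * F z * iteratedFDeriv ℝ 3 (sqOnFiber F z.proj) z.2 ![u, v, w]

/-- `F : TM → [0, ∞)` is a Finsler structure on `M`. -/
structure IsFinslerStructure (F : TangentBundle 𝓘(ℝ, E) M → ℝ) : Prop where
  nonneg : ∀ z, 0 ≤ F z
  smooth : ContMDiffOn 𝓘(ℝ, E).tangent 𝓘(ℝ, ℝ) ∞ F (slit E M)
  homogeneous : ∀ (x : M) (y : TangentSpace 𝓘(ℝ, E) x) (t : ℝ), 0 < t →
    F ⟨x, t • y⟩ = t * F ⟨x, y⟩
  posDef : ∀ z ∈ slit E M, ∀ u : TangentSpace 𝓘(ℝ, E) z.proj, u ≠ 0 →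
    0 < fundamentalTensor F z u u

/-- `F` is Riemannian: `g_{(x,y)}` does not depend on `y ≠ 0`. -/
def IsRiemannian (F : TangentBundle 𝓘(ℝ, E) M → ℝ) : Prop :=
  ∀ (x : M) (y y' : TangentSpace 𝓘(ℝ, E) x), y ≠ 0 → y' ≠ 0 →
    ∀ u v : TangentSpace 𝓘(ℝ, E) x,
      fundamentalTensor F ⟨x, y⟩ u v = fundamentalTensor F ⟨x, y'⟩ u v

/-! ## Finsler connections -/

variable (E M) in
/-- The projection `π : TM → M` as a smooth map. -/
abbrev tangentProj : ContMDiffMap 𝓘(ℝ, E).tangent 𝓘(ℝ, E) (TangentBundle 𝓘(ℝ, E) M) M ∞ :=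
  ⟨TotalSpace.proj, contMDiff_proj _⟩

variable (E M) in
/-- The pulled-back tangent bundle `π^*TM`: its fibre over `z` is `T_{π(z)} M`. It is only used
over the open subset `TM₀`. -/
abbrev PullTM : TangentBundle 𝓘(ℝ, E) M → Type _ :=
  (tangentProj E M : TangentBundle 𝓘(ℝ, E) M → M) *ᵖ (TangentSpace 𝓘(ℝ, E) : M → Type _)

instance (z : TangentBundle 𝓘(ℝ, E) M) : AddCommGroup (PullTM E M z) :=
  { (inferInstance : AddCommMonoid (PullTM E M z)),
    (inferInstance : AddCommGroup (TangentSpace 𝓘(ℝ, E) z.proj)) with }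

instance (z : TangentBundle 𝓘(ℝ, E) M) : IsTopologicalAddGroup (PullTM E M z) :=
  (inferInstance : IsTopologicalAddGroup (TangentSpace 𝓘(ℝ, E) z.proj))

instance (z : TangentBundle 𝓘(ℝ, E) M) : ContinuousSMul ℝ (PullTM E M z) :=
  (inferInstance : ContinuousSMul ℝ (TangentSpace 𝓘(ℝ, E) z.proj))

/-- Differentiability at `z` of a section of `π^*TM`. -/
def SectionDiffAt (X : ∀ z, PullTM E M z) (z : TangentBundle 𝓘(ℝ, E) M) : Prop :=
  MDifferentiableAt 𝓘(ℝ, E).tangent (𝓘(ℝ, E).tangent.prod 𝓘(ℝ, E))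
    (fun w => (TotalSpace.mk' E w (X w) : TotalSpace E (PullTM E M))) z

/-- Differentiability at `z` of a vector field on `TM`. -/
def FieldDiffAt (V : ∀ z : TangentBundle 𝓘(ℝ, E) M, TangentSpace 𝓘(ℝ, E).tangent z)
    (z : TangentBundle 𝓘(ℝ, E) M) : Prop :=
  MDifferentiableAt 𝓘(ℝ, E).tangent 𝓘(ℝ, E).tangent.tangent
    (fun w => (⟨w, V w⟩ : TangentBundle 𝓘(ℝ, E).tangent (TangentBundle 𝓘(ℝ, E) M))) z

/-- The canonical map `ρ_z = dπ_z : T_z TM → (π^*TM)_z = T_{π(z)} M`. -/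
def rho (z : TangentBundle 𝓘(ℝ, E) M) :
    TangentSpace 𝓘(ℝ, E).tangent z →L[ℝ] PullTM E M z :=
  mfderiv 𝓘(ℝ, E).tangent 𝓘(ℝ, E)
    (TotalSpace.proj : TangentBundle 𝓘(ℝ, E) M → M) z

/-- The tautological section `F ℓ : z ↦ (z, z)` of `π^*TM`. -/
def tautSection (z : TangentBundle 𝓘(ℝ, E) M) : PullTM E M z := z.2

variable (E M) in
/-- A Finsler connection: a smooth linear connection `D` on `π^*TM → TM₀` such that
`μ_z : V ↦ D_V (F ℓ)` maps the vertical space `ker ρ_z` isomorphically onto `T_{π(z)} M`.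

The derivative `D_V X` at `z`, for `V ∈ T_z TM₀` and a section `X` of `π^*TM`, is `D.cov X z V`.
Sections are total functions on `TM`, but all conditions live on `TM₀` only. -/
structure FinslerConnection where
  cov : (∀ z, PullTM E M z) →
    (∀ z : TangentBundle 𝓘(ℝ, E) M, TangentSpace 𝓘(ℝ, E).tangent z →L[ℝ] PullTM E M z)
  isCovariantDerivativeOn : IsCovariantDerivativeOn E cov (slit E M)
  smooth : ContMDiffCovariantDerivativeOn E ∞ cov (slit E M)
  vertical_bijOn : ∀ z ∈ slit E M,
    BijOn (cov tautSection z) {V | rho z V = 0} univ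

/-- The map `μ_z : T_z TM₀ → T_{π(z)} M`, `V ↦ D_V (F ℓ)`. -/
def FinslerConnection.mu (D : FinslerConnection E M) (z : TangentBundle 𝓘(ℝ, E) M) :
    TangentSpace 𝓘(ℝ, E).tangent z →L[ℝ] PullTM E M z :=
  D.cov tautSection z

/-- Two connections on `π^*TM → TM₀` coincide. -/
def FinslerConnection.Coincide (D D' : FinslerConnection E M) : Prop :=
  ∀ z ∈ slit E M, ∀ X : ∀ z, PullTM E M z, SectionDiffAt X z → D.cov X z = D'.cov X z

/-- `ρ_z` is onto. -/
theorem rho_surjective (z : TangentBundle 𝓘(ℝ, E) M) (u : PullTM E M z) :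
    ∃ V, rho z V = u := by
  have hM : IsManifold 𝓘(ℝ, E) 1 M := IsManifold.of_le (n := ∞) (by simp)
  obtain ⟨x, y⟩ := z
  let s : M → TangentBundle 𝓘(ℝ, E) M := fun p => ⟨p, FiberBundle.extend E y p⟩
  have hs : MDifferentiableAt 𝓘(ℝ, E) 𝓘(ℝ, E).tangent s x :=
    FiberBundle.mdifferentiableAt_extend 𝓘(ℝ, E) E y
  have hsx : s x = ⟨x, y⟩ := by simp [s]
  have hπ : MDifferentiableAt 𝓘(ℝ, E).tangent 𝓘(ℝ, E)
      (TotalSpace.proj : TangentBundle 𝓘(ℝ, E) M → M) (s x) :=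
    (contMDiff_proj (n := 1) _).mdifferentiable one_ne_zero _
  have h := mfderiv_comp x hπ hs
  have hid : (TotalSpace.proj : TangentBundle 𝓘(ℝ, E) M → M) ∘ s = id := rfl
  rw [hid, mfderiv_id, hsx] at h
  exact ⟨mfderiv 𝓘(ℝ, E) 𝓘(ℝ, E).tangent s x u, (DFunLike.congr_fun h u).symm⟩

/-- For a Finsler connection, every vector of `T_{π(z)} M` has exactly one horizontal lift to
`T_z TM₀`, i.e. one lift lying in the horizontal space `ker μ_z`. -/
theorem existsUnique_horizontal_lift (D : FinslerConnection E M)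
    {z : TangentBundle 𝓘(ℝ, E) M} (hz : z ∈ slit E M) (u : PullTM E M z) :
    ∃! V : TangentSpace 𝓘(ℝ, E).tangent z, D.mu z V = 0 ∧ rho z V = u := by
  obtain ⟨V₀, hV₀⟩ := rho_surjective z u
  obtain ⟨W, hW, hW'⟩ := (D.vertical_bijOn z hz).surjOn (mem_univ (D.mu z V₀))
  have hW1 : rho z W = 0 := hW
  have hW2 : D.mu z W = D.mu z V₀ := hW'
  refine ⟨V₀ - W, ⟨by simp [hW2], by simp [hW1, hV₀]⟩, ?_⟩
  rintro V ⟨hV1, hV2⟩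
  have h : V - V₀ = -W := by
    refine (D.vertical_bijOn z hz).injOn (?_ : rho z _ = 0) (?_ : rho z _ = 0)
      (?_ : D.mu z _ = D.mu z _)
    · simp [hV2, hV₀]
    · simp [hW1]
    · simp [hV1, hW2]
  rw [sub_eq_iff_eq_add] at h
  rw [h]; abel

/-- The vector field `ℓ̄` on `TM₀`: `ℓ̄_z` is the unique horizontal vector with
`ρ(ℓ̄_z) = ℓ_z = F(z)⁻¹ z`. -/
def FinslerConnection.ellBar (D : FinslerConnection E M) (F : TangentBundle 𝓘(ℝ, E) M → ℝ)
    (z : TangentBundle 𝓘(ℝ, E) M) : TangentSpace 𝓘(ℝ, E).tangent z :=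
  Classical.epsilon fun V => D.mu z V = 0 ∧ rho z V = (F z)⁻¹ • tautSection z

theorem FinslerConnection.ellBar_spec (D : FinslerConnection E M)
    (F : TangentBundle 𝓘(ℝ, E) M → ℝ) {z : TangentBundle 𝓘(ℝ, E) M} (hz : z ∈ slit E M) :
    D.mu z (D.ellBar F z) = 0 ∧ rho z (D.ellBar F z) = (F z)⁻¹ • tautSection z :=
  Classical.epsilon_spec (existsUnique_horizontal_lift D hz _).exists

/-! ## Tensors, torsion and almost-compatibility -/

variable (E M) in
/-- Covariant 3-tensors on `π^*TM` (as functions on the fibres). -/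
abbrev Tensor3 : Type _ :=
  ∀ z : TangentBundle 𝓘(ℝ, E) M, PullTM E M z → PullTM E M z → PullTM E M z → ℝ

/-- Compatible tensors: trilinear (by symmetry it is enough to ask for linearity in the first
argument), symmetric, annihilated by `ℓ`, positively homogeneous of degree zero in `y`. -/
structure IsCompatible (F : TangentBundle 𝓘(ℝ, E) M → ℝ) (S : Tensor3 E M) : Prop where
  linear : ∀ z ∈ slit E M, ∀ v w, IsLinearMap ℝ fun u => S z u v w
  symm_left : ∀ z ∈ slit E M, ∀ u v w, S z u v w = S z v u w
  symm_right : ∀ z ∈ slit E M, ∀ u v w, S z u v w = S z u w v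
  apply_ell : ∀ z ∈ slit E M, ∀ u v, S z u v ((F z)⁻¹ • tautSection z) = 0
  homogeneous : ∀ (x : M) (y : TangentSpace 𝓘(ℝ, E) x) (t : ℝ), y ≠ 0 → 0 < t →
    ∀ u v w : TangentSpace 𝓘(ℝ, E) x, S ⟨x, t • y⟩ u v w = S ⟨x, y⟩ u v w

/-- The torsion `D_V Y - D_W X - ρ[V, W]`, where `X = ρ(V)` and `Y = ρ(W)`. -/
def FinslerConnection.torsion (D : FinslerConnection E M)
    (V W : ∀ z : TangentBundle 𝓘(ℝ, E) M, TangentSpace 𝓘(ℝ, E).tangent z)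
    (z : TangentBundle 𝓘(ℝ, E) M) : PullTM E M z :=
  D.cov (fun p => rho p (W p)) z (V z) - D.cov (fun p => rho p (V p)) z (W z)
    - rho z (VectorField.mlieBracket 𝓘(ℝ, E).tangent V W z)

/-- `(D_V g)(X, Y) = V g(X, Y) - g(D_V X, Y) - g(X, D_V Y)` at `z`, for `V ∈ T_z TM₀`. -/
def FinslerConnection.derivMetric (D : FinslerConnection E M)
    (F : TangentBundle 𝓘(ℝ, E) M → ℝ) (X Y : ∀ z, PullTM E M z)
    (z : TangentBundle 𝓘(ℝ, E) M) (V : TangentSpace 𝓘(ℝ, E).tangent z) : ℝ :=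
  mvfderiv 𝓘(ℝ, E).tangent (fun p => fundamentalTensor F p (X p) (Y p)) z V
    - fundamentalTensor F z (D.cov X z V) (Y z) - fundamentalTensor F z (X z) (D.cov Y z V)

/-- `D` is the connection with compatible tensors `S` and `T` on `(M, F)`:
* its torsion is `F⁻¹ T(μ(V), ρ(W)) - F⁻¹ T(μ(W), ρ(V))`, the vector `T(X, Y)` being defined by
  `g(T(X, Y), Z) = T(X, Y, Z)`;
* it is almost compatible:
  `(D_V g)(X, Y) = 2 A(ρ(V), X, Y) + 2 F⁻¹ A(μ(V), X, Y) - 2 S(ρ(V), X, Y) - 2 F⁻¹ T(μ(V), X, Y)`.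
-/
structure HasCompatibleTensors (D : FinslerConnection E M)
    (F : TangentBundle 𝓘(ℝ, E) M → ℝ) (S T : Tensor3 E M) : Prop where
  compatible_S : IsCompatible F S
  compatible_T : IsCompatible F T
  torsion_eq : ∀ z ∈ slit E M,
    ∀ V W : ∀ z : TangentBundle 𝓘(ℝ, E) M, TangentSpace 𝓘(ℝ, E).tangent z,
    FieldDiffAt V z → FieldDiffAt W z → ∀ Z : PullTM E M z,
      fundamentalTensor F z (D.torsion V W z) Z =
        (F z)⁻¹ * T z (D.mu z (V z)) (rho z (W z)) Z
          - (F z)⁻¹ * T z (D.mu z (W z)) (rho z (V z)) Z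
  almost_compatible : ∀ z ∈ slit E M, ∀ X Y : ∀ z, PullTM E M z,
    SectionDiffAt X z → SectionDiffAt Y z → ∀ V : TangentSpace 𝓘(ℝ, E).tangent z,
      D.derivMetric F X Y z V =
        2 * cartanTensor F z (rho z V) (X z) (Y z)
          + 2 * (F z)⁻¹ * cartanTensor F z (D.mu z V) (X z) (Y z)
          - 2 * S z (rho z V) (X z) (Y z) - 2 * (F z)⁻¹ * T z (D.mu z V) (X z) (Y z)

/-! ## Derivatives of the Cartan tensor and types of connections -/

/-- The tensor `Ṡ`, the covariant derivative of `S` along `ℓ̄`: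
`Ṡ(X, Y, Z) = ℓ̄ S(X, Y, Z) - S(D_ℓ̄ X, Y, Z) - S(X, D_ℓ̄ Y, Z) - S(X, Y, D_ℓ̄ Z)`. Its value on
vectors `u, v, w` at `z` is computed with sections of `π^*TM` that are smooth near `z` and take
the values `u, v, w` at `z`. -/
def dotTensor (D : FinslerConnection E M) (F : TangentBundle 𝓘(ℝ, E) M → ℝ)
    (S : Tensor3 E M) : Tensor3 E M := fun z u v w =>
  let X : ∀ z, PullTM E M z := FiberBundle.extend E u
  let Y : ∀ z, PullTM E M z := FiberBundle.extend E v
  let Z : ∀ z, PullTM E M z := FiberBundle.extend E w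
  mvfderiv 𝓘(ℝ, E).tangent (fun p => S p (X p) (Y p) (Z p)) z (D.ellBar F z)
    - S z (D.cov X z (D.ellBar F z)) v w - S z u (D.cov Y z (D.ellBar F z)) w
    - S z u v (D.cov Z z (D.ellBar F z))

/-- The tensors `A, Ȧ, Ä, …` of the connection `D`. -/
def cartanDeriv (D : FinslerConnection E M) (F : TangentBundle 𝓘(ℝ, E) M → ℝ) :
    ℕ → Tensor3 E M
  | 0 => cartanTensor F
  | i + 1 => dotTensor D F (cartanDeriv D F i)

/-- A general-type Finsler connection with constants `κ₀, …, κ_m` and `r`: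
`S = κ₀ A + κ₁ Ȧ + ⋯ + κ_m A^{(m)}` and `T = r A`. -/
def IsGeneralType (D : FinslerConnection E M) (F : TangentBundle 𝓘(ℝ, E) M → ℝ)
    {m : ℕ} (κ : Fin (m + 1) → ℝ) (r : ℝ) : Prop :=
  HasCompatibleTensors D F
    (fun z u v w => ∑ i : Fin (m + 1), κ i * cartanDeriv D F i z u v w)
    (fun z u v w => r * cartanTensor F z u v w)

/-- The Berwald-type connection with constants `κ₁, …, κ_m`:
`S = A + κ₁ Ȧ + ⋯ + κ_m A^{(m)}` and `T = 0`. -/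
def IsBerwaldType (D : FinslerConnection E M) (F : TangentBundle 𝓘(ℝ, E) M → ℝ)
    {m : ℕ} (κ : Fin m → ℝ) : Prop :=
  IsGeneralType D F (Fin.cons 1 κ : Fin (m + 1) → ℝ) 0

/-- The Shen-type connection with constants `κ₁, …, κ_m`:
`S = κ₁ Ȧ + ⋯ + κ_m A^{(m)}` and `T = 0`. -/
def IsShenType (D : FinslerConnection E M) (F : TangentBundle 𝓘(ℝ, E) M → ℝ)
    {m : ℕ} (κ : Fin m → ℝ) : Prop :=
  IsGeneralType D F (Fin.cons 0 κ : Fin (m + 1) → ℝ) 0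

end FinslerGeom

end

/-! Both directions pass through the vanishing of the Cartan tensor A on TM₀. Since A is F/2 times
∂g/∂y and F does not vanish off the zero section, A = 0 says that g is locally constant on each T_xM
\ {0}. This set is connected when n ≥ 2 and empty when n = 0, so A = 0 is equivalent to F being
Riemannian (`IsFinslerStructure.cartanTensor_eq_zero_iff`).

If the connections coincide, they have the same ℓ̄ and the same iterated derivatives of A. The two
almost-compatibility equations then differ only by the term 2A(ρ(V), X, Y), which must vanish; ρ is
onto, so A = 0 (`cartanTensor_eq_zero_of_coincide`).

If A = 0, every iterated derivative of A vanishes too, so both connections are torsion-free and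
metric. The uniqueness argument for the Levi-Civita connection makes them equal
(`FinslerConnection.coincide_of_torsion_derivMetric`). -/

namespace FinslerGeom

open scoped Topology

/-! ### Differentiability of sections and fields on the slit tangent bundle -/

section

variable {E : Type*} [NormedAddCommGroup E] [NormedSpace ℝ E]
  {M : Type*} [TopologicalSpace M] [ChartedSpace E M] [IsManifold 𝓘(ℝ, E) ∞ M]

/-- The inclusion of a fibre into the tangent bundle is smooth. -/
theorem contMDiff_fiberInclusion (x : M) :
    ContMDiff 𝓘(ℝ, E) 𝓘(ℝ, E).tangent ∞
      (fun y : E => (⟨x, y⟩ : TangentBundle 𝓘(ℝ, E) M)) := by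
  intro y
  rw [contMDiffAt_totalSpace]
  refine ⟨contMDiffAt_const, ?_⟩
  let e := trivializationAt E (TangentSpace 𝓘(ℝ, E)) x
  have hx : x ∈ e.baseSet := FiberBundle.mem_baseSet_trivializationAt' x
  let L : E →L[ℝ] E := e.continuousLinearMapAt ℝ x
  refine L.contMDiff.contMDiffAt.congr_of_eventuallyEq (.of_forall fun v => ?_)
  exact (e.continuousLinearMapAt_apply_of_mem ℝ hx v).symm

/-- Trivializations are linear on fibres, so y ≠ 0 can be tested on the continuous fibre coordinate.
Openness turns identities on TM₀ into identities of germs, which can be differentiated. -/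
theorem isOpen_slit : IsOpen (slit E M) := by
  rw [isOpen_iff_mem_nhds]
  intro z hz
  have hM : IsManifold 𝓘(ℝ, E) 1 M := IsManifold.of_le (n := ∞) (by simp)
  let e := trivializationAt E (TangentSpace 𝓘(ℝ, E)) z.proj
  have key : ∀ w : TangentBundle 𝓘(ℝ, E) M, w ∈ e.source → ((e w).2 = 0 ↔ w.2 = 0) := by
    intro w hw
    have hb : w.proj ∈ e.baseSet := e.mem_source.1 hw
    have h1 : (e w).2 = e.continuousLinearEquivAt ℝ w.proj hb w.2 := by
      rw [e.coe_continuousLinearEquivAt_eq hb]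
      exact (e.continuousLinearMapAt_apply_of_mem ℝ hb w.2).symm
    rw [h1]
    exact map_eq_zero_iff _ (ContinuousLinearEquiv.injective _)
  have hzs : z ∈ e.source :=
    e.mem_source.2 (FiberBundle.mem_baseSet_trivializationAt' (F := E)
        (E := (TangentSpace 𝓘(ℝ, E) : M → Type _)) z.proj)
  have hc : ContinuousAt (fun w => (e w).2) z :=
    continuous_snd.continuousAt.comp (e.continuousAt hzs)
  have hne : (e z).2 ≠ 0 := fun h => hz ((key z hzs).1 h)
  filter_upwards [hc.eventually_ne hne, e.open_source.mem_nhds hzs] with w hw hws h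
  exact hw ((key w hws).2 h)

/-- Both sides have the same fibre coordinate, and π is differentiable. As a map into TM, the
tautological section is the identity and ρ(W) is the tangent map of π composed with W. -/
theorem sectionDiffAt_iff (X : ∀ z, PullTM E M z) (z : TangentBundle 𝓘(ℝ, E) M) :
    SectionDiffAt X z ↔ MDifferentiableAt 𝓘(ℝ, E).tangent 𝓘(ℝ, E).tangent
      (fun w => (⟨w.proj, X w⟩ : TangentBundle 𝓘(ℝ, E) M)) z := by
  unfold SectionDiffAt
  rw [mdifferentiableAt_totalSpace]
  refine Iff.trans ?_ (mdifferentiableAt_totalSpace 𝓘(ℝ, E)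
    (fun w => (⟨w.proj, X w⟩ : TangentBundle 𝓘(ℝ, E) M))).symm
  have hM : IsManifold 𝓘(ℝ, E) 1 M := IsManifold.of_le (n := ∞) (by simp)
  have h1 : MDifferentiableAt 𝓘(ℝ, E).tangent 𝓘(ℝ, E)
      (fun w : TangentBundle 𝓘(ℝ, E) M => w.proj) z :=
    (contMDiff_proj (n := 1) _).mdifferentiable one_ne_zero _
  refine ⟨fun h => ⟨h1, h.2⟩, fun h => ⟨mdifferentiableAt_id, h.2⟩⟩

theorem sectionDiffAt_tautSection (z : TangentBundle 𝓘(ℝ, E) M) :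
    SectionDiffAt (tautSection : ∀ z, PullTM E M z) z :=
  (sectionDiffAt_iff _ z).2 mdifferentiableAt_id

theorem sectionDiffAt_rho {W : ∀ z : TangentBundle 𝓘(ℝ, E) M, TangentSpace 𝓘(ℝ, E).tangent z}
    {z : TangentBundle 𝓘(ℝ, E) M} (hW : FieldDiffAt W z) :
    SectionDiffAt (fun w => rho w (W w)) z := by
  rw [sectionDiffAt_iff]
  have h : ContMDiff 𝓘(ℝ, E).tangent.tangent 𝓘(ℝ, E).tangent 1
      (tangentMap 𝓘(ℝ, E).tangent 𝓘(ℝ, E)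
        (TotalSpace.proj : TangentBundle 𝓘(ℝ, E) M → M)) :=
    (contMDiff_proj (n := 2) _).contMDiff_tangentMap (by norm_num)
  exact ((h.mdifferentiable one_ne_zero) _).comp z hW

theorem sectionDiffAt_extend {z : TangentBundle 𝓘(ℝ, E) M} (u : PullTM E M z) :
    SectionDiffAt (FiberBundle.extend E u) z :=
  FiberBundle.mdifferentiableAt_extend 𝓘(ℝ, E).tangent E u

theorem exists_fieldDiffAt {z : TangentBundle 𝓘(ℝ, E) M} (v : TangentSpace 𝓘(ℝ, E).tangent z) :
    ∃ V : ∀ z : TangentBundle 𝓘(ℝ, E) M, TangentSpace 𝓘(ℝ, E).tangent z,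
      FieldDiffAt V z ∧ V z = v := by
  have hM : IsManifold 𝓘(ℝ, E) 1 M := IsManifold.of_le (n := ∞) (by simp)
  have hM : IsManifold 𝓘(ℝ, E).tangent 1 (TangentBundle 𝓘(ℝ, E) M) :=
    IsManifold.of_le (n := ∞) (by simp)
  refine ⟨FiberBundle.extend (E × E) v, ?_, by simp⟩
  exact FiberBundle.mdifferentiableAt_extend 𝓘(ℝ, E).tangent (E × E) v

end

/-! ### Fibrewise calculus: the Cartan tensor and the Riemannian condition -/

section fibre

variable {E : Type*} [NormedAddCommGroup E] [NormedSpace ℝ E]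
  {M : Type*} [TopologicalSpace M] [ChartedSpace E M] [IsManifold 𝓘(ℝ, E) ∞ M]
  {F : TangentBundle 𝓘(ℝ, E) M → ℝ}

theorem IsFinslerStructure.contDiffAt_sqOnFiber (hF : IsFinslerStructure F) (x : M) {y : E}
    (hy : y ≠ 0) : ContDiffAt ℝ ∞ (sqOnFiber F x) y := by
  have h1 : ContMDiffAt 𝓘(ℝ, E).tangent 𝓘(ℝ, ℝ) ∞ F ⟨x, y⟩ :=
    (hF.smooth ⟨x, y⟩ hy).contMDiffAt (isOpen_slit.mem_nhds hy)
  have h2 : ContMDiffAt 𝓘(ℝ, E) 𝓘(ℝ, ℝ) ∞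
      (fun y : E => F (⟨x, y⟩ : TangentBundle 𝓘(ℝ, E) M)) y :=
    h1.comp y (contMDiff_fiberInclusion x y)
  exact h2.contDiffAt.pow 2

theorem IsFinslerStructure.differentiableAt_iteratedFDeriv_two (hF : IsFinslerStructure F) (x : M)
    {y : E} (hy : y ≠ 0) :
    DifferentiableAt ℝ (iteratedFDeriv ℝ 2 (sqOnFiber F x)) y :=
  (hF.contDiffAt_sqOnFiber x hy).differentiableAt_iteratedFDeriv
    (WithTop.coe_lt_coe.2 (ENat.natCast_lt_top 2))

/-- The second derivative of a function vanishing along a ray vanishes along that ray. -/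
theorem fderiv_fderiv_apply_self_eq_zero {E : Type*} [NormedAddCommGroup E] [NormedSpace ℝ E]
    {f : E → ℝ} {y : E} (hf : ∀ t : ℝ, 0 < t → ContDiffAt ℝ 2 f (t • y))
    (hvan : ∀ t : ℝ, 0 < t → f (t • y) = 0) : fderiv ℝ (fderiv ℝ f) y y y = 0 := by
  have hline : ∀ t : ℝ, HasDerivAt (fun s : ℝ => s • y) y t := fun t => by
    simpa using (hasDerivAt_id t).smul_const y
  have hfirst : ∀ t : ℝ, 0 < t → fderiv ℝ f (t • y) y = 0 := fun t ht => by
    have h1 := ((hf t ht).differentiableAt (by simp)).hasFDerivAt.comp_hasDerivAt t (hline t)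
    have h2 : HasDerivAt (f ∘ fun s : ℝ => s • y) 0 t :=
      (hasDerivAt_const t (0 : ℝ)).congr_of_eventuallyEq
        (Filter.mem_of_superset (Ioi_mem_nhds ht) fun s hs => hvan s hs)
    exact h1.unique h2
  have hd : DifferentiableAt ℝ (fderiv ℝ f) ((1 : ℝ) • y) :=
    ((hf 1 one_pos).fderiv_right (m := 1) (by norm_num)).differentiableAt one_ne_zero
  have h0 : HasDerivAt (fun s : ℝ => fderiv ℝ f (s • y))
      (fderiv ℝ (fderiv ℝ f) ((1 : ℝ) • y) y) 1 := hd.hasFDerivAt.comp_hasDerivAt 1 (hline 1)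
  have h1 : HasDerivAt (fun s : ℝ => fderiv ℝ f (s • y) y)
      (fderiv ℝ (fderiv ℝ f) ((1 : ℝ) • y) y y) 1 :=
    (ContinuousLinearMap.apply ℝ ℝ y).hasFDerivAt.comp_hasDerivAt 1 h0
  have h2 : HasDerivAt (fun s : ℝ => fderiv ℝ f (s • y) y) 0 1 :=
    (hasDerivAt_const (1 : ℝ) (0 : ℝ)).congr_of_eventuallyEq
      (Filter.mem_of_superset (Ioi_mem_nhds one_pos) fun s hs => hfirst s hs)
  rw [one_smul] at h1
  exact h1.unique h2

/-- A Finsler function does not vanish on nonzero vectors. -/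
theorem IsFinslerStructure.ne_zero (hF : IsFinslerStructure F) {z : TangentBundle 𝓘(ℝ, E) M}
    (hz : z ∈ slit E M) : F z ≠ 0 := by
  obtain ⟨x, y⟩ := z
  intro h0
  change E at y
  have hy : y ≠ 0 := hz
  -- By homogeneity, F² would vanish on the whole ray through y, forcing g(y, y) = 0 against
  -- positive definiteness.
  have hvan : ∀ t : ℝ, 0 < t → sqOnFiber F x (t • y) = 0 := fun t ht => by
    have h := hF.homogeneous x y t ht
    rw [h0, mul_zero] at h
    change F ⟨x, t • y⟩ ^ 2 = 0
    rw [show F ⟨x, t • y⟩ = 0 from h]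
    norm_num
  have hsecond := fderiv_fderiv_apply_self_eq_zero
    (fun t ht => (hF.contDiffAt_sqOnFiber x (smul_ne_zero ht.ne' hy)).of_le
      (WithTop.coe_le_coe.2 le_top)) hvan
  have hpos := hF.posDef ⟨x, y⟩ hz y hy
  have heq : fundamentalTensor F ⟨x, y⟩ y y =
      (1 / 2) * fderiv ℝ (fderiv ℝ (sqOnFiber F x)) y y y := by
    simp only [fundamentalTensor]
    rw [iteratedFDeriv_two_apply]
    rfl
  rw [heq, hsecond] at hpos
  simp at hpos

omit [IsManifold 𝓘(ℝ, E) ∞ M] in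
-- Recasts independence of y as constancy of a map into a normed space, so that a vanishing
-- derivative can be used.
theorem fundamentalTensor_eq_iff {x : M} {y y' : E} :
    (∀ u v : E, fundamentalTensor F ⟨x, y⟩ u v = fundamentalTensor F ⟨x, y'⟩ u v) ↔
      iteratedFDeriv ℝ 2 (sqOnFiber F x) y = iteratedFDeriv ℝ 2 (sqOnFiber F x) y' := by
  constructor
  · intro h
    ext m
    have hm : m = ![m 0, m 1] := by ext i; fin_cases i <;> rfl
    have := h (m 0) (m 1)
    simp only [fundamentalTensor] at this
    rw [hm]
    linarith
  · intro h u v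
    simp only [fundamentalTensor]
    rw [h]

/-- The Cartan tensor vanishes at `(x, y)` iff `∂g/∂y` does. -/
theorem IsFinslerStructure.cartanTensor_eq_zero_iff_fderiv (hF : IsFinslerStructure F) {x : M}
    {y : E} (hy : y ≠ 0) :
    (∀ u v w : E, cartanTensor F ⟨x, y⟩ u v w = 0) ↔
      fderiv ℝ (iteratedFDeriv ℝ 2 (sqOnFiber F x)) y = 0 := by
  constructor
  · intro h
    ext u m
    have hm : Matrix.vecCons u m = ![u, m 0, m 1] := by ext i; fin_cases i <;> rfl
    have h1 : F ⟨x, y⟩ ≠ 0 := hF.ne_zero (z := ⟨x, y⟩) hy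
    have h2 := h u (m 0) (m 1)
    simp only [cartanTensor] at h2
    have h3 : iteratedFDeriv ℝ 3 (sqOnFiber F x) y ![u, m 0, m 1] = 0 := by
      rcases mul_eq_zero.1 h2 with h | h
      · exact absurd h (mul_ne_zero (by norm_num) h1)
      · exact h
    rw [← hm, iteratedFDeriv_succ_apply_left] at h3
    exact h3
  · intro h u v w
    simp only [cartanTensor]
    refine mul_eq_zero_of_right _ ?_
    rw [iteratedFDeriv_succ_apply_left]
    exact congrArg (fun L => L u ![v, w]) h

/-- The Cartan tensor vanishes on the slit tangent bundle iff the metric is Riemannian. -/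
theorem IsFinslerStructure.cartanTensor_eq_zero_iff [FiniteDimensional ℝ E]
    (hF : IsFinslerStructure F) (hdim : Module.finrank ℝ E ≠ 1) :
    (∀ z ∈ slit E M, ∀ u v w, cartanTensor F z u v w = 0) ↔ IsRiemannian F := by
  constructor
  · intro h x y y' hy hy' u v
    change E at y y' u v
    -- A nonzero y excludes dimension 0 and `hdim` excludes 1; from dimension 2 on, the complement
    -- of the origin is connected.
    have hrank : 1 < Module.rank ℝ E := by
      have h0 : Module.finrank ℝ E ≠ 0 := fun h0 => by
        have := Module.finrank_zero_iff.1 h0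
        exact hy (Subsingleton.elim (α := E) y 0)
      rw [← Module.finrank_eq_rank]
      exact_mod_cast (by omega : 1 < Module.finrank ℝ E)
    refine fundamentalTensor_eq_iff.2 ?_ u v
    refine isOpen_compl_singleton.is_const_of_fderiv_eq_zero (𝕜 := ℝ) (s := ({0} : Set E)ᶜ)
      (isConnected_compl_singleton_of_one_lt_rank hrank 0).isPreconnected
      (fun a ha => (hF.differentiableAt_iteratedFDeriv_two x ha).differentiableWithinAt)
      (fun a ha => ?_) hy hy'
    exact (hF.cartanTensor_eq_zero_iff_fderiv ha).1 (h ⟨x, a⟩ ha)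
  · rintro h ⟨x, y⟩ hy
    change E at y
    refine (hF.cartanTensor_eq_zero_iff_fderiv hy).2 ?_
    have hev : iteratedFDeriv ℝ 2 (sqOnFiber F x) =ᶠ[𝓝 y]
        fun _ => iteratedFDeriv ℝ 2 (sqOnFiber F x) y := by
      filter_upwards [isOpen_compl_singleton.mem_nhds (show (y : E) ∈ ({0} : Set E)ᶜ from hy)]
        with a ha
      exact fundamentalTensor_eq_iff.1 (h x a y ha hy)
    rw [hev.fderiv_eq]
    simp

end fibre
-- Comparison of Finsler connections
section connections

variable {E : Type*} [NormedAddCommGroup E] [NormedSpace ℝ E]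
  {M : Type*} [TopologicalSpace M] [ChartedSpace E M] [IsManifold 𝓘(ℝ, E) ∞ M]
  {F : TangentBundle 𝓘(ℝ, E) M → ℝ} {D D' : FinslerConnection E M}

theorem FinslerConnection.Coincide.ellBar_eq (h : D.Coincide D')
    {z : TangentBundle 𝓘(ℝ, E) M} (hz : z ∈ slit E M) : D.ellBar F z = D'.ellBar F z := by
  have hmu : D.mu z = D'.mu z := h z hz _ (sectionDiffAt_tautSection z)
  simp only [FinslerConnection.ellBar, hmu]

/-- Only the germ of S at z and the values of D on sections differentiable at z enter, and the
extensions used are differentiable there. -/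
theorem dotTensor_congr (h : D.Coincide D') {S S' : Tensor3 E M}
    (hS : ∀ z ∈ slit E M, S z = S' z) {z : TangentBundle 𝓘(ℝ, E) M} (hz : z ∈ slit E M) :
    dotTensor D F S z = dotTensor D' F S' z := by
  ext u v w
  have hev : (fun p => S p (FiberBundle.extend E u p) (FiberBundle.extend E v p)
      (FiberBundle.extend E w p)) =ᶠ[𝓝 z] fun p => S' p (FiberBundle.extend E u p)
      (FiberBundle.extend E v p) (FiberBundle.extend E w p) := by
    filter_upwards [isOpen_slit.mem_nhds hz] with p hp
    rw [hS p hp]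
  have hd : mvfderiv 𝓘(ℝ, E).tangent (fun p => S p (FiberBundle.extend E u p)
      (FiberBundle.extend E v p) (FiberBundle.extend E w p)) z =
      mvfderiv 𝓘(ℝ, E).tangent (fun p => S' p (FiberBundle.extend E u p)
      (FiberBundle.extend E v p) (FiberBundle.extend E w p)) z := by
    simp only [mvfderiv]
    rw [hev.mfderiv_eq]
    rfl
  simp only [dotTensor, h.ellBar_eq hz, h z hz _ (sectionDiffAt_extend _), hS z hz, hd]

theorem FinslerConnection.Coincide.cartanDeriv_eq (h : D.Coincide D') (i : ℕ) :
    ∀ z ∈ slit E M, cartanDeriv D F i z = cartanDeriv D' F i z := by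
  induction i with
  | zero => exact fun _ _ => rfl
  | succ i ih => exact fun z hz => dotTensor_congr h ih hz

/-- Induction on i: a tensor vanishing on the open set TM₀ has zero germ at z, so each term of its
derivative along ℓ̄ vanishes. -/
theorem cartanDeriv_eq_zero (hA : ∀ z ∈ slit E M, ∀ u v w, cartanTensor F z u v w = 0) (i : ℕ) :
    ∀ z ∈ slit E M, ∀ u v w, cartanDeriv D F i z u v w = 0 := by
  induction i with
  | zero => exact hA
  | succ i ih =>
    intro z hz u v w
    have hev : (fun p => cartanDeriv D F i p (FiberBundle.extend E u p) (FiberBundle.extend E v p)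
        (FiberBundle.extend E w p)) =ᶠ[𝓝 z] fun _ => 0 := by
      filter_upwards [isOpen_slit.mem_nhds hz] with p hp using ih p hp _ _ _
    have hd : mvfderiv 𝓘(ℝ, E).tangent (fun p => cartanDeriv D F i p (FiberBundle.extend E u p)
        (FiberBundle.extend E v p) (FiberBundle.extend E w p)) z (D.ellBar F z) = 0 := by
      simp only [mvfderiv]
      rw [hev.mfderiv_eq, mfderiv_const]
      rfl
    simp only [cartanDeriv, dotTensor, ih z hz, hd, sub_zero]

theorem fundamentalTensor_eq_fderiv (z : TangentBundle 𝓘(ℝ, E) M) (u v : PullTM E M z) :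
    fundamentalTensor F z u v =
      (1 / 2) * (fderiv ℝ (fderiv ℝ (sqOnFiber F z.proj)) z.2 : E →L[ℝ] E →L[ℝ] ℝ) u v :=
  congrArg ((1 / 2 : ℝ) * ·)
    (iteratedFDeriv_two_apply (sqOnFiber F z.proj) (z.2 : E) ![(u : E), v])

theorem fundamentalTensor_sub_left (z : TangentBundle 𝓘(ℝ, E) M) (u u' v : PullTM E M z) :
    fundamentalTensor F z (u - u') v =
      fundamentalTensor F z u v - fundamentalTensor F z u' v := by
  rw [fundamentalTensor_eq_fderiv z u, fundamentalTensor_eq_fderiv z u',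
    fundamentalTensor_eq_fderiv z (u - u'), ← mul_sub]
  exact congrArg (fun L : E →L[ℝ] ℝ => (1 / 2) * L v)
    (map_sub (fderiv ℝ (fderiv ℝ (sqOnFiber F z.proj)) z.2 : E →L[ℝ] E →L[ℝ] ℝ) u u')

theorem IsFinslerStructure.fundamentalTensor_symm (hF : IsFinslerStructure F)
    {z : TangentBundle 𝓘(ℝ, E) M} (hz : z ∈ slit E M) (u v : PullTM E M z) :
    fundamentalTensor F z u v = fundamentalTensor F z v u := by
  have h := ((hF.contDiffAt_sqOnFiber z.proj hz).isSymmSndFDerivAt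
    (by
      rw [minSmoothness_of_isRCLikeNormedField]
      exact WithTop.coe_le_coe.2 le_top)).eq u v
  rw [fundamentalTensor_eq_fderiv, fundamentalTensor_eq_fderiv z v]
  exact congrArg _ h

/-- Two torsion-free connections whose metric derivatives agree coincide. -/
theorem FinslerConnection.coincide_of_torsion_derivMetric [FiniteDimensional ℝ E]
    (hF : IsFinslerStructure F)
    (htor : ∀ z ∈ slit E M, ∀ V W : ∀ z : TangentBundle 𝓘(ℝ, E) M,
      TangentSpace 𝓘(ℝ, E).tangent z, FieldDiffAt V z → FieldDiffAt W z →
      D.torsion V W z = D'.torsion V W z)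
    (hmet : ∀ z ∈ slit E M, ∀ X Y : ∀ z, PullTM E M z, SectionDiffAt X z → SectionDiffAt Y z →
      ∀ V : TangentSpace 𝓘(ℝ, E).tangent z, D.derivMetric F X Y z V = D'.derivMetric F X Y z V) :
    D.Coincide D' := by
  intro z hz
  have : ContMDiffVectorBundle 1 E (PullTM E M) 𝓘(ℝ, E).tangent :=
    ContMDiffVectorBundle.of_le (n := ∞) (by simp)
  have : IsManifold 𝓘(ℝ, E).tangent 1 (TangentBundle 𝓘(ℝ, E) M) :=
    IsManifold.of_le (n := ∞) (by simp)
  -- The difference of two connections is tensorial: B(x) v depends only on the vectors x and v.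
  let B := IsCovariantDerivativeOn.difference D.isCovariantDerivativeOn
    D'.isCovariantDerivativeOn z
  have hB : ∀ X : ∀ z, PullTM E M z, SectionDiffAt X z → B (X z) = D.cov X z - D'.cov X z :=
    fun X hX => IsCovariantDerivativeOn.difference_apply _ _ hz hX
  -- The bracket terms cancel when the torsions are subtracted.
  have hBsymm : ∀ v w, B (rho z w) v = B (rho z v) w := by
    intro v w
    obtain ⟨V, hV, rfl⟩ := exists_fieldDiffAt v
    obtain ⟨W, hW, rfl⟩ := exists_fieldDiffAt w
    rw [hB _ (sectionDiffAt_rho hV), hB _ (sectionDiffAt_rho hW)]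
    have h := htor z hz V W hV hW
    simp only [FinslerConnection.torsion, sub_left_inj] at h
    exact sub_eq_sub_iff_sub_eq_sub.1 h
  -- The terms V g(X, Y) cancel when the metric derivatives are subtracted.
  have hBskew : ∀ v (x y : PullTM E M z),
      fundamentalTensor F z (B x v) y = - fundamentalTensor F z (B y v) x := by
    intro v x y
    let X : ∀ z, PullTM E M z := FiberBundle.extend E x
    let Y : ∀ z, PullTM E M z := FiberBundle.extend E y
    have hX : SectionDiffAt X z := sectionDiffAt_extend x
    have hY : SectionDiffAt Y z := sectionDiffAt_extend y
    have h := hmet z hz X Y hX hY v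
    have hXz : X z = x := by simp [X]
    have hYz : Y z = y := by simp [Y]
    simp only [FinslerConnection.derivMetric, hXz, hYz] at h
    have h1 := hB X hX
    have h2 := hB Y hY
    rw [hXz] at h1
    rw [hYz] at h2
    have e1 : B x v = D.cov X z v - D'.cov X z v := congrArg (fun L => L v) h1
    have e2 : B y v = D.cov Y z v - D'.cov Y z v := congrArg (fun L => L v) h2
    have f1 := fundamentalTensor_sub_left (F := F) z (D.cov X z v) (D'.cov X z v) y
    have f2 := fundamentalTensor_sub_left (F := F) z (D.cov Y z v) (D'.cov Y z v) x
    rw [← e1] at f1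
    rw [← e2, hF.fundamentalTensor_symm hz (D.cov Y z v),
      hF.fundamentalTensor_symm hz (D'.cov Y z v)] at f2
    linarith
  intro X hX
  ext v
  rw [← sub_eq_zero]
  have e : B (X z) v = D.cov X z v - D'.cov X z v := congrArg (fun L => L v) (hB X hX)
  rw [← e]
  by_contra hne
  refine (hF.posDef z hz _ hne).ne' ?_
  obtain ⟨w, hw⟩ := rho_surjective z (X z)
  obtain ⟨u, hu⟩ := rho_surjective z (B (X z) v)
  -- The form g(B(ρ w) v, ρ u) is symmetric in v, w and skew in w, u; alternating the two symmetries
  -- gives a = -a. Vertical v need no separate treatment, since the symmetry holds on all of T_z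
  -- TM₀.
  have key : fundamentalTensor F z (B (rho z w) v) (rho z u) = 0 := by
    have k1 := hBskew v (rho z w) (rho z u)
    have k2 := hBskew w (rho z v) (rho z u)
    have k3 := hBskew u (rho z v) (rho z w)
    rw [hBsymm v w, hBsymm v u] at k1
    rw [hBsymm w u] at k2
    rw [hBsymm v w]
    linarith
  rw [hw, hu] at key
  exact key

variable {m : ℕ}

theorem sum_cons_mul_cartanDeriv (D : FinslerConnection E M) (a : ℝ) (κ : Fin m → ℝ)
    (z : TangentBundle 𝓘(ℝ, E) M) (u v w : PullTM E M z) :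
    ∑ i : Fin (m + 1), (Fin.cons a κ : Fin (m + 1) → ℝ) i * cartanDeriv D F i z u v w =
      a * cartanTensor F z u v w + ∑ i : Fin m, κ i * cartanDeriv D F (i + 1) z u v w := by
  rw [Fin.sum_univ_succ]
  rfl

/-- If the Berwald-type and Shen-type connections with the same constants coincide, the Cartan
tensor vanishes. -/
theorem cartanTensor_eq_zero_of_coincide {κ : Fin m → ℝ} (hB : IsBerwaldType D F κ)
    (hS : IsShenType D' F κ) (h : D.Coincide D') {z : TangentBundle 𝓘(ℝ, E) M}
    (hz : z ∈ slit E M) (u v w : PullTM E M z) : cartanTensor F z u v w = 0 := by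
  obtain ⟨U, rfl⟩ := rho_surjective z u
  have hv : SectionDiffAt (FiberBundle.extend E v) z := sectionDiffAt_extend v
  have hw : SectionDiffAt (FiberBundle.extend E w) z := sectionDiffAt_extend w
  have h1 := hB.almost_compatible z hz _ _ hv hw U
  have h2 := hS.almost_compatible z hz _ _ hv hw U
  have hmu : D.mu z = D'.mu z := h z hz _ (sectionDiffAt_tautSection z)
  have hmet : D.derivMetric F (FiberBundle.extend E v) (FiberBundle.extend E w) z U =
      D'.derivMetric F (FiberBundle.extend E v) (FiberBundle.extend E w) z U := by
    simp only [FinslerConnection.derivMetric, h z hz _ hv, h z hz _ hw]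
  have e1 := sum_cons_mul_cartanDeriv (F := F) D 1 κ z (rho z U) v w
  have e2 := sum_cons_mul_cartanDeriv (F := F) D' 0 κ z (rho z U) v w
  simp only [h.cartanDeriv_eq _ z hz] at e1
  rw [hmet, h2, hmu, FiberBundle.extend_apply_self, FiberBundle.extend_apply_self] at h1
  simp only [h.cartanDeriv_eq _ z hz] at h1
  -- The coefficients of A in the two tensors S are 1 and 0, and all other terms now agree.
  linarith

/-- When A = 0, the tensors S and T vanish whatever the constants, so these may differ between the
two connections. -/
theorem coincide_of_cartanTensor_eq_zero [FiniteDimensional ℝ E] (hF : IsFinslerStructure F)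
    (hA : ∀ z ∈ slit E M, ∀ u v w, cartanTensor F z u v w = 0)
    {m' : ℕ} {κ : Fin (m + 1) → ℝ} {κ' : Fin (m' + 1) → ℝ} {r r' : ℝ}
    (hD : IsGeneralType D F κ r) (hD' : IsGeneralType D' F κ' r') : D.Coincide D' := by
  refine FinslerConnection.coincide_of_torsion_derivMetric hF ?_ ?_
  · intro z hz V W hV hW
    rw [← sub_eq_zero]
    by_contra hne
    have hpos := hF.posDef z hz _ hne
    -- The torsion is known only through its pairings under g; pairing the difference with itself
    -- brings in positive definiteness.
    set Z := D.torsion V W z - D'.torsion V W z with hZ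
    have h1 := hD.torsion_eq z hz V W hV hW Z
    have h2 := hD'.torsion_eq z hz V W hV hW Z
    have hA' : ∀ u v w : PullTM E M z, cartanTensor F z u v w = 0 := hA z hz
    simp only [hA', mul_zero, sub_zero] at h1 h2
    have h3 := fundamentalTensor_sub_left (F := F) z (D.torsion V W z) (D'.torsion V W z) Z
    rw [← hZ] at h3
    linarith
  · intro z hz X Y hX hY V
    rw [hD.almost_compatible z hz X Y hX hY V, hD'.almost_compatible z hz X Y hX hY V]
    have hA' : ∀ u v w : PullTM E M z, cartanTensor F z u v w = 0 := hA z hz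
    simp [hA', cartanDeriv_eq_zero hA _ z hz]

end connections
end FinslerGeom

theorem mainTheorem9 {E : Type*} [NormedAddCommGroup E] [NormedSpace ℝ E] [FiniteDimensional ℝ E]
    {M : Type*} [TopologicalSpace M] [T2Space M] [SecondCountableTopology M]
    [ChartedSpace E M] [IsManifold 𝓘(ℝ, E) ∞ M]
    (hdim : Module.finrank ℝ E ≠ 1)
    (F : TangentBundle 𝓘(ℝ, E) M → ℝ) (hF : FinslerGeom.IsFinslerStructure F)
    {m : ℕ} (κ : Fin m → ℝ) (DB DS : FinslerGeom.FinslerConnection E M)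
    (hB : FinslerGeom.IsBerwaldType DB F κ) (hS : FinslerGeom.IsShenType DS F κ) :
    DB.Coincide DS ↔ FinslerGeom.IsRiemannian F := by
  rw [← hF.cartanTensor_eq_zero_iff hdim]
  exact ⟨fun h z hz u v w => FinslerGeom.cartanTensor_eq_zero_of_coincide hB hS h hz u v w,
    fun hA => FinslerGeom.coincide_of_cartanTensor_eq_zero hF hA hB hS⟩
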